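/- Let $h\ge 0$, let $f,g:[0,\infty)\to[0,\infty)$ and $K:\mathbb R\to[0,\infty)$ satisfy the following hypothesis $(\mathcal F)$: $f$ is locally Lipschitz and strictly increasing, $g$ is continuous, $f(0)=g(0)=0$, $g(t)>0$ for $t>0$, the (right) derivatives $f'(0)$, $g'(0)$ exist and $0<f'(0)<g'(0)<+\infty$, $f(+\infty)>\sup_{s\ge 0}g(s)$ (where $f(+\infty)\in(0,+\infty]$), and $K$ is integrable with $\int_{\mathbb R}K(s)\,ds=1$. For $c\in\mathbb R$ consider the wave-profile equation $$y''(t)-cy'(t)-f(y(t))+\int_{\mathbb R}K(s)\,g(y(t-s-ch))\,ds=0,\qquad t\in\mathbb R. \tag{twe}$$ A positive bounded solution with speed $c$ is a bounded $C^2$ function $\phi:\mathbb R\to(0,\infty)$ satisfying (twe). It is a semi-wavefront if $\phi(-\infty)=0$ or $\phi(+\infty)=0$, and a pulse if $\phi(-\infty)=\phi(+\infty)=0$. For real $z$ with $\int_{\mathbb R}K(s)e^{-zs}ds<\infty$ put $$\chi_1(z,c)=z^2-cz-f'(0)+g'(0)e^{-zch}\int_{\mathbb R}K(s)e^{-zs}\,ds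 .$$ The critical speeds are the extended real numbers $$c_*^+=\inf\{c\in\mathbb R:\ \chi_1(z,c)=0\text{ for some } z>0\},\qquad c_*^-=\sup\{c\in\mathbb R:\ \chi_1(z,c)=0\text{ for some } z<0\},$$ where only those $z$ are admitted for which the integral in $\chi_1$ converges, and $\inf\emptyset=+\infty$, $\sup\emptyset=-\infty$. Then: 1. If $\phi$ is a positive bounded solution of (twe) with speed $c$ and $\liminf_{s\to-\infty}\phi(s)=0$, then $\phi(-\infty)=0$, $c_*^+$ is finite and $c\ge c_*^+$. 2. If $\phi$ is a positive bounded solution of (twe) with speed $c$ and $\liminf_{s\to+\infty}\phi(s)=0$, then $\phi(+\infty)=0$, $c_*^-$ is finite and $c\le c_*^-$. 3. Equation (twe) has no pulses, whatever the speed $c\in\mathbb R$. 4. Equation (twe) has no semi-wavefronts with speed $c\in(c_*^-,c_*^+)$. -/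

import Mathlib

open Set Filter Topology MeasureTheory

noncomputable section

/-- The derivative at `0` of a function defined on `[0, ∞)`, i.e. its right derivative at `0`. -/
def derivZero (f : ℝ → ℝ) : ℝ := derivWithin f (Ici 0) 0

/-- Hypothesis `(F)` on `f, g : [0, ∞) → [0, ∞)` (given as real functions of which only the values
on `[0, ∞)` matter) and on the kernel `K`. -/
structure HypF (f g K : ℝ → ℝ) : Prop where
  f_locallyLipschitz : LocallyLipschitzOn (Ici 0) f
  f_strictMono : StrictMonoOn f (Ici 0)
  f_zero : f 0 = 0
  f_diff_zero : DifferentiableWithinAt ℝ f (Ici 0) 0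
  f_deriv_pos : 0 < derivZero f
  g_continuous : ContinuousOn g (Ici 0)
  g_zero : g 0 = 0
  g_pos : ∀ t : ℝ, 0 < t → 0 < g t
  g_diff_zero : DifferentiableWithinAt ℝ g (Ici 0) 0
  f_deriv_lt_g_deriv : derivZero f < derivZero g
  /-- `f(+∞) > sup_{s ≥ 0} g(s)`, where `f(+∞)` may be `+∞`. -/
  f_top_gt : ∃ L : EReal, Tendsto (fun s : ℝ => (f s : EReal)) atTop (𝓝 L) ∧
    (⨆ s ∈ Ici (0 : ℝ), (g s : EReal)) < L
  K_nonneg : ∀ s : ℝ, 0 ≤ K s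
  K_integrable : Integrable K
  K_integral : ∫ s : ℝ, K s = 1

/-- `φ` is a positive bounded `C²` solution of
`y''(t) - c y'(t) - f(y(t)) + ∫ K(s) g(y(t - s - c h)) ds = 0`. -/
structure IsPositiveBoundedSolution (f g K : ℝ → ℝ) (h c : ℝ) (φ : ℝ → ℝ) : Prop where
  contDiff : ContDiff ℝ 2 φ
  pos : ∀ t : ℝ, 0 < φ t
  bdd : BddAbove (range φ)
  eqn : ∀ t : ℝ, deriv (deriv φ) t - c * deriv φ t - f (φ t)
    + ∫ s : ℝ, K s * g (φ (t - s - c * h)) = 0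

/-- A semi-wavefront profile of speed `c`: it vanishes at `-∞` or at `+∞`. -/
def IsSemiWavefront (f g K : ℝ → ℝ) (h c : ℝ) (φ : ℝ → ℝ) : Prop :=
  IsPositiveBoundedSolution f g K h c φ ∧ (Tendsto φ atBot (𝓝 0) ∨ Tendsto φ atTop (𝓝 0))

/-- A pulse profile of speed `c`: it vanishes both at `-∞` and at `+∞`. -/
def IsPulse (f g K : ℝ → ℝ) (h c : ℝ) (φ : ℝ → ℝ) : Prop :=
  IsPositiveBoundedSolution f g K h c φ ∧ Tendsto φ atBot (𝓝 0) ∧ Tendsto φ atTop (𝓝 0)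

/-- `z` is admissible if the integral `∫ K(s) e^{-zs} ds` in `χ₁` converges. -/
def Admissible (K : ℝ → ℝ) (z : ℝ) : Prop := Integrable (fun s : ℝ => K s * Real.exp (-z * s))

/-- `χ₁(z, c) = z² - c z - f'(0) + g'(0) e^{-zch} ∫ K(s) e^{-zs} ds`, for admissible `z`. -/
def chiOne (f g K : ℝ → ℝ) (h z c : ℝ) : ℝ :=
  z ^ 2 - c * z - derivZero f
    + derivZero g * Real.exp (-z * c * h) * ∫ s : ℝ, K s * Real.exp (-z * s)

/-- `c_*^+`: the least speed for which `χ₁(·, c)` has a positive zero (`+∞` if there is none). -/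
def criticalSpeedPlus (f g K : ℝ → ℝ) (h : ℝ) : EReal :=
  sInf ((fun c : ℝ => (c : EReal)) ''
    {c : ℝ | ∃ z : ℝ, 0 < z ∧ Admissible K z ∧ chiOne f g K h z c = 0})

/-- `c_*^-`: the greatest speed for which `χ₁(·, c)` has a negative zero (`-∞` if there is none). -/
def criticalSpeedMinus (f g K : ℝ → ℝ) (h : ℝ) : EReal :=
  sSup ((fun c : ℝ => (c : EReal)) ''
    {c : ℝ | ∃ z : ℝ, z < 0 ∧ Admissible K z ∧ chiOne f g K h z c = 0})

end

/-! Where a solution φ is small it is a positive supersolution of a linear operator: replace f by a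
slope p slightly above f'(0), g by a slope q slightly below g'(0), and cut the kernel, shifted by
ch, to a bounded window (`truncOp_nonpos`). The truncated characteristic functions increase with the
window; at each z they tend to χ₁ or, if z is not admissible, become unbounded. So positivity of χ₁
on a compact set passes to one of them.

The core is `exists_length_not_max_right`: if χ₁(·, c) > 0 at all admissible z > 0, a small solution
cannot attain its maximum over a long interval at the right end. Let k be the exponent in the
Harnack inequality for φ, and minimise the truncated function over [-ε, k + 1]. At an interior
minimum the derivative vanishes, and a compactly supported bump e^{z(t-m)}(1 - y(t-m)²)₊² of any
size is a subsolution, which excludes positive supersolutions altogether. At an endpoint minimum a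
difference of two exponentials is a subsolution; Harnack orders it below φ outside the interval, and
inside it exceeds the supposed maximum. Reflection t ↦ -t gives the version for z < 0 and left ends.

By convexity and χ₁(0, c) > 0, nonpositive values cannot occur on both sides of 0, so one of the two
versions always applies. A solution with liminf 0 at -∞ but no limit has long small excursions
between equal heights, where the maximum sits at both ends; hence it converges. A solution tending
to 0 at -∞ has small running maxima, so χ₁ ≤ 0 at some z > 0. Moving c down to a zero of χ₁ gives
the speed bound, and a pulse would produce nonpositive values on both sides. -/

/-- The second-order necessary condition at a local minimum. -/
theorem IsLocalMin.deriv_deriv_nonneg {u : ℝ → ℝ} {x : ℝ} (hu : ContinuousAt u x)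
    (hmin : IsLocalMin u x) : 0 ≤ deriv (deriv u) x := by
  by_contra! hneg
  have hd : deriv u x = 0 := hmin.deriv_eq_zero
  have hmax : IsLocalMax u x := isLocalMax_of_deriv_deriv_neg hneg hd hu
  have hc : u =ᶠ[𝓝 x] fun _ => u x := by
    filter_upwards [hmin, hmax] with y h1 h2 using le_antisymm h2 h1
  have h2 : deriv (deriv u) x = 0 := by
    have h3 : deriv u =ᶠ[𝓝 x] fun _ => 0 := by
      filter_upwards [hc.eventuallyEq_nhds] with y hy
      rw [hy.deriv_eq, deriv_const]
    rw [h3.deriv_eq, deriv_const]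
  linarith

theorem ContDiff.hasDerivAt_deriv_two {φ : ℝ → ℝ} (hφ : ContDiff ℝ 2 φ) (t : ℝ) :
    HasDerivAt φ (deriv φ t) t ∧ HasDerivAt (deriv φ) (deriv (deriv φ) t) t := by
  refine ⟨(hφ.differentiable (by norm_num) t).hasDerivAt, ?_⟩
  have h1 : ContDiff ℝ 1 (deriv φ) :=
    ((contDiff_succ_iff_deriv (n := 1) (f := φ)).1 (by simpa [one_add_one_eq_two] using hφ)).2.2
  exact (h1.differentiable (by norm_num) t).hasDerivAt

/-- The derivatives of the reflection `t ↦ φ (-t)`. -/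
theorem deriv_comp_neg_two {φ : ℝ → ℝ} (t : ℝ) :
    deriv (fun x => φ (-x)) t = -deriv φ (-t) ∧
      deriv (deriv fun x => φ (-x)) t = deriv (deriv φ) (-t) := by
  have h1 : (deriv fun x => φ (-x)) = fun t => -deriv φ (-t) := by
    funext t; exact deriv_comp_neg φ t
  refine ⟨congrFun h1 t, ?_⟩
  rw [h1, deriv.fun_neg, deriv_comp_neg, neg_neg]

/-! ### Harnack inequality -/

/-- A positive solution of `φ'' - (b - a) φ' - a b φ ≤ 0` satisfies `φ' + a φ ≥ 0`. -/
theorem deriv_add_mul_nonneg_of_supersolution {φ : ℝ → ℝ} {a b : ℝ} (hφ : ContDiff ℝ 2 φ)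
    (hpos : ∀ t, 0 < φ t) (ha : 0 < a) (hb : 0 < b)
    (hineq : ∀ t, deriv (deriv φ) t - (b - a) * deriv φ t ≤ a * b * φ t) (t : ℝ) :
    0 ≤ deriv φ t + a * φ t := by
  by_contra! hneg
  set w : ℝ → ℝ := fun t => deriv φ t + a * φ t with hw
  have hwd : ∀ x, HasDerivAt w (deriv (deriv φ) x + a * deriv φ x) x := fun x =>
    (hφ.hasDerivAt_deriv_two x).2.add ((hφ.hasDerivAt_deriv_two x).1.const_mul a)
  have hexp : ∀ k x : ℝ, HasDerivAt (fun x => Real.exp (k * x)) (Real.exp (k * x) * k) x :=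
    fun k x => by simpa using ((hasDerivAt_id x).const_mul k).exp
  -- The operator factors as (D - b)(D + a), so w' ≤ b w and a negative value of w persists to the
  -- right.
  have hanti : Antitone fun x => w x * Real.exp (-b * x) := by
    have hd := fun x => (hwd x).mul (hexp (-b) x)
    refine antitone_of_deriv_nonpos (fun x => (hd x).differentiableAt) fun x => ?_
    have := (hd x).deriv
    simp only [Pi.mul_def] at this
    rw [this]
    have h1 := hineq x
    have h2 := Real.exp_pos (-b * x)
    have : (deriv (deriv φ) x + a * deriv φ x) - b * w x ≤ 0 := by simp only [hw]; linarith
    nlinarith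
  have hwle : ∀ x, t ≤ x → w x * Real.exp (a * x) ≤ w t * Real.exp (a * t) := by
    intro x hx
    have h1 : w x * Real.exp (-b * x) ≤ w t * Real.exp (-b * t) := hanti hx
    have h2 : w x ≤ w t * Real.exp (b * (x - t)) := by
      have h3 := mul_le_mul_of_nonneg_right h1 (Real.exp_pos (b * x)).le
      rw [mul_assoc, mul_assoc, ← Real.exp_add, ← Real.exp_add] at h3
      rw [show -b * x + b * x = 0 by ring, Real.exp_zero, mul_one,
        show -b * t + b * x = b * (x - t) by ring] at h3
      exact h3
    have h4 : w x ≤ w t := by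
      have : 1 ≤ Real.exp (b * (x - t)) := Real.one_le_exp (by nlinarith)
      nlinarith
    have h5 : Real.exp (a * t) ≤ Real.exp (a * x) := Real.exp_le_exp.2 (by nlinarith)
    have h6 := Real.exp_pos (a * t)
    nlinarith
  -- The derivative of φ e^{ax} is w e^{ax} ≤ m < 0 to the right of t, so φ e^{ax} would be
  -- nonpositive at t + P / (-m).
  set m := w t * Real.exp (a * t)
  have hm : m < 0 := mul_neg_of_neg_of_pos hneg (Real.exp_pos _)
  have hdu : ∀ x, HasDerivAt (fun x => φ x * Real.exp (a * x) - m * x)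
      (w x * Real.exp (a * x) - m) x := fun x => by
    refine (((hφ.hasDerivAt_deriv_two x).1.mul (hexp a x)).sub
      ((hasDerivAt_id x).const_mul m)).congr_deriv ?_
    simp only [hw]; ring
  have hanti2 : AntitoneOn (fun x => φ x * Real.exp (a * x) - m * x) (Ici t) := by
    refine antitoneOn_of_deriv_nonpos (convex_Ici t)
      (fun x _ => (hdu x).continuousAt.continuousWithinAt)
      (fun x _ => (hdu x).differentiableAt.differentiableWithinAt) fun x hx => ?_
    rw [interior_Ici] at hx
    rw [(hdu x).deriv]
    linarith [hwle x hx.le]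
  set P := φ t * Real.exp (a * t)
  have hP : 0 < P := mul_pos (hpos t) (Real.exp_pos _)
  have hx : t ≤ t + P / (-m) := by
    have : 0 < P / (-m) := div_pos hP (by linarith)
    linarith
  have h7 := hanti2 self_mem_Ici (mem_Ici.2 hx) hx
  simp only at h7
  have h8 : m * (t + P / (-m)) = m * t - P := by
    field_simp [hm.ne]
    ring
  have h9 := mul_pos (hpos (t + P / (-m))) (Real.exp_pos (a * (t + P / (-m))))
  change _ ≤ P - m * t at h7
  linarith

theorem mul_exp_le_of_supersolution {φ : ℝ → ℝ} {a b : ℝ} (hφ : ContDiff ℝ 2 φ)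
    (hpos : ∀ t, 0 < φ t) (ha : 0 < a) (hb : 0 < b)
    (hineq : ∀ t, deriv (deriv φ) t - (b - a) * deriv φ t ≤ a * b * φ t) {s t : ℝ} (hst : s ≤ t) :
    φ s * Real.exp (-a * (t - s)) ≤ φ t := by
  have hexp : ∀ x : ℝ, HasDerivAt (fun x => Real.exp (a * x)) (Real.exp (a * x) * a) x :=
    fun x => by simpa using ((hasDerivAt_id x).const_mul a).exp
  have hmono : Monotone fun x => φ x * Real.exp (a * x) := by
    have hd := fun x => (hφ.hasDerivAt_deriv_two x).1.mul (hexp x)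
    refine monotone_of_deriv_nonneg (fun x => (hd x).differentiableAt) fun x => ?_
    have := (hd x).deriv
    simp only [Pi.mul_def] at this
    rw [this]
    have h1 := deriv_add_mul_nonneg_of_supersolution hφ hpos ha hb hineq x
    have h2 := Real.exp_pos (a * x)
    nlinarith
  have h := mul_le_mul_of_nonneg_right (hmono hst) (Real.exp_pos (-a * t)).le
  simp only at h
  rw [mul_assoc, mul_assoc, ← Real.exp_add, ← Real.exp_add] at h
  rw [show a * t + -a * t = 0 by ring, Real.exp_zero, mul_one,
    show a * s + -a * t = -a * (t - s) by ring] at h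
  exact h

/-- Harnack inequality for positive solutions of `φ'' - c φ' ≤ β φ`. -/
theorem exists_harnack (c : ℝ) {β : ℝ} (hβ : 0 < β) : ∃ k : ℝ, 0 < k ∧ ∀ φ : ℝ → ℝ,
    ContDiff ℝ 2 φ → (∀ t, 0 < φ t) → (∀ t, deriv (deriv φ) t - c * deriv φ t ≤ β * φ t) →
      ∀ s t, φ s * Real.exp (-k * |t - s|) ≤ φ t := by
  -- Here b and -a are the two roots of z² - cz - β.
  set r := Real.sqrt (c ^ 2 + 4 * β) with hr
  have hr2 : r ^ 2 = c ^ 2 + 4 * β := Real.sq_sqrt (by positivity)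
  have hrc : |c| < r := by
    rw [← Real.sqrt_sq_eq_abs]; exact Real.sqrt_lt_sqrt (sq_nonneg c) (by linarith)
  obtain ⟨h1, h2⟩ := abs_lt.1 hrc
  set a := (r - c) / 2 with ha
  set b := (r + c) / 2 with hb
  have ha0 : 0 < a := by simp only [ha]; linarith
  have hb0 : 0 < b := by simp only [hb]; linarith
  have hba : b - a = c := by simp only [ha, hb]; ring
  have hab : a * b = β := by simp only [ha, hb]; nlinarith
  refine ⟨max a b, lt_max_of_lt_left ha0, fun φ hφ hpos hineq s t => ?_⟩
  rcases le_total s t with hst | hst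
  · refine le_trans ?_ (mul_exp_le_of_supersolution hφ hpos ha0 hb0 (by rwa [hba, hab]) hst)
    rw [abs_of_nonneg (by linarith)]
    have := le_max_left a b
    exact mul_le_mul_of_nonneg_left (Real.exp_le_exp.2 (by nlinarith)) (hpos s).le
  -- Reflection changes the sign of c and therefore exchanges a and b.
  · have h3 := mul_exp_le_of_supersolution (φ := fun x => φ (-x)) (hφ.comp contDiff_neg)
      (fun t => hpos _) hb0 ha0 (fun t => by
        obtain ⟨e1, e2⟩ := deriv_comp_neg_two (φ := φ) t
        rw [e1, e2, mul_comm b a, hab]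
        have := hineq (-t)
        have hba' : a - b = -c := by linarith
        rw [hba']; linarith) (neg_le_neg hst)
    simp only [neg_neg] at h3
    refine le_trans ?_ h3
    rw [abs_of_nonpos (by linarith)]
    have := le_max_right a b
    exact mul_le_mul_of_nonneg_left (Real.exp_le_exp.2 (by nlinarith)) (hpos s).le

/-! ### Comparison for the truncated linear operator -/

/-- The operator `φ'' - c φ' - p φ + q ∫_{|s| ≤ R} N(s) φ(t - s) ds`. -/
noncomputable def truncOp (N : ℝ → ℝ) (R c p q : ℝ) (φ : ℝ → ℝ) (t : ℝ) : ℝ :=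
  deriv (deriv φ) t - c * deriv φ t - p * φ t + q * ∫ s in Icc (-R) R, N s * φ (t - s)

/-- The characteristic function of `truncOp`. -/
noncomputable def truncChar (N : ℝ → ℝ) (R c p q z : ℝ) : ℝ :=
  z ^ 2 - c * z - p + q * ∫ s in Icc (-R) R, N s * Real.exp (-z * s)

theorem MeasureTheory.Integrable.integrableOn_Icc_mul {N v : ℝ → ℝ} (hN : Integrable N)
    (hv : Continuous v) (a b : ℝ) : IntegrableOn (fun s => N s * v s) (Icc a b) :=
  hN.integrableOn.mul_continuousOn hv.continuousOn isCompact_Icc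

/-- Comparison of a positive supersolution with a function `v` whose positive part is a strict
subsolution. -/
theorem le_of_supersolution_of_subsolution {N φ v w : ℝ → ℝ} {R c p q l r : ℝ}
    (hN0 : ∀ s, 0 ≤ N s) (hN : Integrable N) (hR : 0 ≤ R) (hq : 0 ≤ q) (hφ : ContDiff ℝ 2 φ)
    (hpos : ∀ t, 0 < φ t) (hv : Continuous v) (hw : ContDiff ℝ 2 w)
    (hvw : ∀ t, 0 < v t → v t = w t)
    (hsuper : ∀ t ∈ Ioo l r, truncOp N R c p q φ t ≤ 0)
    (hsub : ∀ t ∈ Ioo l r, 0 < v t → 0 < deriv (deriv w) t - c * deriv w t - p * w t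
      + q * ∫ s in Icc (-R) R, N s * v (t - s))
    (hbd : ∀ t ∈ Icc (l - R) (r + R), t ∉ Ioo l r → v t ≤ φ t) :
    ∀ t ∈ Ioo l r, v t ≤ φ t := by
  intro t₁ ht₁
  have hsubset : Ioo l r ⊆ Icc (l - R) (r + R) := fun t ht =>
    ⟨by linarith [ht.1], by linarith [ht.2]⟩
  -- Maximise v / φ over the interval together with its collar of width R. If the maximum κ exceeds
  -- 1, it is attained inside, where κφ touches v from above; evaluating the operator there
  -- contradicts strictness.
  obtain ⟨t₀, ht₀, hmax⟩ := isCompact_Icc.exists_isMaxOn ⟨t₁, hsubset ht₁⟩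
    (f := fun t => v t / φ t)
    ((hv.div hφ.continuous fun t => (hpos t).ne').continuousOn)
  set κ := v t₀ / φ t₀ with hκ
  have hle : ∀ t ∈ Icc (l - R) (r + R), v t ≤ κ * φ t := fun t ht =>
    (div_le_iff₀ (hpos t)).1 (hmax ht)
  by_cases hκ1 : κ ≤ 1
  · have := hle t₁ (hsubset ht₁)
    nlinarith [hpos t₁]
  push Not at hκ1
  have heq : v t₀ = κ * φ t₀ := by rw [hκ, div_mul_cancel₀ _ (hpos t₀).ne']
  have hv0 : 0 < v t₀ := by rw [heq]; exact mul_pos (by linarith) (hpos _)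
  have ht₀' : t₀ ∈ Ioo l r := by
    by_contra hcon
    have := hbd t₀ ht₀ hcon
    nlinarith [hpos t₀]
  set u : ℝ → ℝ := fun t => κ * φ t - w t with hu
  have hu1 : ∀ t, HasDerivAt u (κ * deriv φ t - deriv w t) t := fun t =>
    ((hφ.hasDerivAt_deriv_two t).1.const_mul κ).sub (hw.hasDerivAt_deriv_two t).1
  have hdu : deriv u = fun t => κ * deriv φ t - deriv w t := funext fun t => (hu1 t).deriv
  have hddu : deriv (deriv u) t₀ = κ * deriv (deriv φ) t₀ - deriv (deriv w) t₀ := by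
    rw [hdu]
    exact (((hφ.hasDerivAt_deriv_two t₀).2.const_mul κ).sub (hw.hasDerivAt_deriv_two t₀).2).deriv
  have hmin : IsLocalMin u t₀ := by
    filter_upwards [hv.continuousAt.eventually (lt_mem_nhds hv0), isOpen_Ioo.mem_nhds ht₀']
      with t h1 h2
    have h3 := hle t (hsubset h2)
    simp only [hu]
    rw [← hvw t h1, ← hvw t₀ hv0]
    linarith
  have h1 : κ * deriv φ t₀ - deriv w t₀ = 0 := by rw [← (hu1 t₀).deriv]; exact hmin.deriv_eq_zero
  have h2 := hmin.deriv_deriv_nonneg (hu1 t₀).continuousAt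
  rw [hddu] at h2
  have h3 : ∫ s in Icc (-R) R, N s * v (t₀ - s) ≤ κ * ∫ s in Icc (-R) R, N s * φ (t₀ - s) := by
    rw [← integral_const_mul]
    refine setIntegral_mono_on (hN.integrableOn_Icc_mul (by fun_prop) _ _)
      ((hN.integrableOn_Icc_mul (by have := hφ.continuous; fun_prop) _ _).const_mul _)
      measurableSet_Icc fun s hs => ?_
    have := hle (t₀ - s) ⟨by linarith [ht₀'.1, hs.2], by linarith [ht₀'.2, hs.1]⟩
    nlinarith [hN0 s]
  have h4 := hsub t₀ ht₀' hv0
  have h5 := hsuper t₀ ht₀'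
  rw [truncOp] at h5
  have h6 : w t₀ = κ * φ t₀ := by rw [← hvw t₀ hv0, heq]
  rw [h6] at h4
  have h7 := mul_le_mul_of_nonneg_left h3 hq
  have h8 := mul_nonpos_of_nonneg_of_nonpos (by linarith : 0 ≤ κ) h5
  have h9 : deriv w t₀ = κ * deriv φ t₀ := by linarith
  rw [h9] at h4
  nlinarith

/-! ### Explicit subsolutions and long intervals -/

theorem hasDerivAt_exp_mul_sub (z m t : ℝ) :
    HasDerivAt (fun t => Real.exp (z * (t - m))) (z * Real.exp (z * (t - m))) t := by
  have := (((hasDerivAt_id t).sub_const m).const_mul z).exp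
  simpa [mul_comm] using this

theorem deriv_deriv_eq_of_hasDerivAt {w w' w'' : ℝ → ℝ} (h1 : ∀ t, HasDerivAt w (w' t) t)
    (h2 : ∀ t, HasDerivAt w' (w'' t) t) (t : ℝ) : deriv w t = w' t ∧ deriv (deriv w) t = w'' t := by
  have h3 : deriv w = w' := funext fun t => (h1 t).deriv
  exact ⟨congrFun h3 t, by rw [h3]; exact (h2 t).deriv⟩

/-- Tangent-line bound for the convex function a ↦ (a₊)². It bounds the convolution of the truncated
bump below by moments of the kernel. -/
theorem two_mul_sub_sq_le_max_sq (a : ℝ) {b : ℝ} (hb : 0 < b) :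
    2 * a * b - b ^ 2 ≤ max 0 a ^ 2 := by
  rcases le_total 0 a with h | h
  · rw [max_eq_right h]; nlinarith [sq_nonneg (a - b)]
  · rw [max_eq_left h]; nlinarith

/-- If the characteristic function is positive at a critical point, there are no positive
supersolutions on long intervals. -/
theorem exists_length_no_supersolution {N : ℝ → ℝ} {R c p q z : ℝ}
    (hN0 : ∀ s, 0 ≤ N s) (hN : Integrable N) (hR : 0 ≤ R) (hq : 0 ≤ q)
    (hχ : 0 < truncChar N R c p q z)
    (hcrit : 2 * z - c - q * ∫ s in Icc (-R) R, N s * (Real.exp (-z * s) * s) = 0) :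
    ∃ d : ℝ, 0 < d ∧ ∀ (φ : ℝ → ℝ) (m : ℝ), ContDiff ℝ 2 φ → (∀ t, 0 < φ t) →
      (∀ t ∈ Ioo (m - d) (m + d), truncOp N R c p q φ t ≤ 0) → False := by
  set J0 := ∫ s in Icc (-R) R, N s * Real.exp (-z * s) with hJ0
  set J1 := ∫ s in Icc (-R) R, N s * (Real.exp (-z * s) * s) with hJ1
  set J2 := ∫ s in Icc (-R) R, N s * (Real.exp (-z * s) * s ^ 2) with hJ2
  set X := truncChar N R c p q z with hX
  have hXe : X = z ^ 2 - c * z - p + q * J0 := rfl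
  have hJ2n : 0 ≤ J2 := setIntegral_nonneg measurableSet_Icc fun s _ =>
    mul_nonneg (hN0 s) (mul_nonneg (Real.exp_pos _).le (sq_nonneg s))
  -- With P = 1 - y(t-m)², the operator on the bump is at least e(XP² + 8y - yBP): the 12 collects
  -- -4yP and the -8yP in 8y²(t-m)² = 8y(1 - P), and 2qJ2 comes from the second moment. The choice
  -- of y makes this ey((BP/4 - 2)² + 4) > 0.
  set B := 12 + 2 * (q * J2) with hB
  have hB0 : 0 < B := by have := mul_nonneg hq hJ2n; linarith
  set y := 16 * X / B ^ 2 with hy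
  have hy0 : 0 < y := by positivity
  have hXy : X = y * B ^ 2 / 16 := by rw [hy]; field_simp
  set d := 1 / Real.sqrt y with hd
  have hd0 : 0 < d := by positivity
  have hyd : y * d ^ 2 = 1 := by
    rw [hd, div_pow, Real.sq_sqrt hy0.le]; field_simp
  refine ⟨d, hd0, fun φ m hφ hpos hsuper => ?_⟩
  -- The bump vanishes outside the interval, so its height is free; twice φ m contradicts comparison
  -- at m.
  obtain ⟨κ, hκ⟩ : ∃ κ, κ = 2 * φ m := ⟨_, rfl⟩
  have hκ0 : 0 < κ := by have := hpos m; linarith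
  set P : ℝ → ℝ := fun t => 1 - y * (t - m) ^ 2 with hP
  set w : ℝ → ℝ := fun t => κ * Real.exp (z * (t - m)) * P t ^ 2 with hw
  set v : ℝ → ℝ := fun t => κ * Real.exp (z * (t - m)) * max 0 (P t) ^ 2 with hv
  have hPd : ∀ t, HasDerivAt P (-2 * y * (t - m)) t := fun t => by
    refine (((((hasDerivAt_id t).sub_const m).pow 2).const_mul y).const_sub 1).congr_deriv ?_
    simp; ring
  have hw1 : ∀ t, HasDerivAt w (κ * Real.exp (z * (t - m)) *
      (z * P t ^ 2 + -4 * y * ((t - m) * P t))) t := fun t => by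
    refine (((hasDerivAt_exp_mul_sub z m t).const_mul κ).mul ((hPd t).pow 2)).congr_deriv ?_
    simp; ring
  have hw2 : ∀ t, HasDerivAt (fun t => κ * Real.exp (z * (t - m)) *
      (z * P t ^ 2 + -4 * y * ((t - m) * P t))) (κ * Real.exp (z * (t - m)) *
      (z ^ 2 * P t ^ 2 + 2 * z * (-4 * y * ((t - m) * P t)) + -4 * y * P t
        + 8 * y ^ 2 * (t - m) ^ 2)) t := fun t => by
    refine (((hasDerivAt_exp_mul_sub z m t).const_mul κ).mul ((((hPd t).pow 2).const_mul z).add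
      ((((hasDerivAt_id t).sub_const m).mul (hPd t)).const_mul (-4 * y)))).congr_deriv ?_
    simp; ring
  have hPout : ∀ t, t ∉ Ioo (m - d) (m + d) → P t ≤ 0 := by
    intro t ht
    have : d ^ 2 ≤ (t - m) ^ 2 := by
      by_contra! hcon
      obtain ⟨h1, h2⟩ := abs_lt.1 (abs_lt_of_sq_lt_sq hcon hd0.le)
      exact ht ⟨by linarith, by linarith⟩
    have := mul_le_mul_of_nonneg_left this hy0.le
    simp only [hP]; linarith
  have key : ∀ t ∈ Ioo (m - d) (m + d), v t ≤ φ t := by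
    refine le_of_supersolution_of_subsolution (w := w) hN0 hN hR hq hφ hpos
      (by simp only [hv, hP]; fun_prop) (by simp only [hw, hP]; fun_prop) ?_ hsuper ?_ ?_
    · intro t ht
      have : 0 < P t := by
        by_contra! hcon
        simp [hv, max_eq_left hcon] at ht
      simp [hv, hw, max_eq_right this.le]
    · intro t _ ht
      have hPt : 0 < P t := by
        by_contra! hcon
        simp [hv, max_eq_left hcon] at ht
      obtain ⟨e1, e2⟩ := deriv_deriv_eq_of_hasDerivAt hw1 hw2 t
      rw [e1, e2]
      set e := κ * Real.exp (z * (t - m)) with he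
      have he0 : 0 < e := by positivity
      set x := t - m with hx
      have hI : e * (P t ^ 2 * J0 - -4 * y * (x * P t) * J1 - 2 * P t * y * J2)
          ≤ ∫ s in Icc (-R) R, N s * v (t - s) := by
        have i0 := hN.integrableOn_Icc_mul (v := fun s => Real.exp (-z * s)) (by fun_prop) (-R) R
        have i1 := hN.integrableOn_Icc_mul (v := fun s => Real.exp (-z * s) * s)
          (by fun_prop) (-R) R
        have i2 := hN.integrableOn_Icc_mul (v := fun s => Real.exp (-z * s) * s ^ 2)
          (by fun_prop) (-R) R
        have i01 : IntegrableOn (fun s => P t ^ 2 * (N s * Real.exp (-z * s))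
            - -4 * y * (x * P t) * (N s * (Real.exp (-z * s) * s))) (Icc (-R) R) :=
          (i0.const_mul _).sub (i1.const_mul _)
        rw [hJ0, hJ1, hJ2, ← integral_const_mul, ← integral_const_mul, ← integral_const_mul,
          ← integral_sub (i0.const_mul _) (i1.const_mul _),
          ← integral_sub i01 (i2.const_mul _),
          ← integral_const_mul]
        refine setIntegral_mono_on ((i01.sub (i2.const_mul _)).const_mul _) (hN.integrableOn_Icc_mul (by simp only [hv, hP]; fun_prop)
          _ _) measurableSet_Icc fun s _ => ?_
        have hexp : κ * Real.exp (z * (t - s - m)) = e * Real.exp (-z * s) := by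
          rw [he, show z * (t - s - m) = z * x + -z * s by rw [hx]; ring, Real.exp_add, mul_assoc]
        have hu : 2 * P (t - s) * P t - P t ^ 2 ≤ max 0 (P (t - s)) ^ 2 :=
          two_mul_sub_sq_le_max_sq _ hPt
        have hPs : P (t - s) = P t + 2 * y * x * s - y * s ^ 2 := by simp only [hP, hx]; ring
        rw [hPs] at hu
        simp only [hv]
        rw [hexp, hPs]
        have := mul_le_mul_of_nonneg_left hu
          (mul_nonneg (hN0 s) (mul_nonneg he0.le (Real.exp_pos (-z * s)).le))
        linarith
      have hyx : y * x ^ 2 = 1 - P t := by simp only [hP, hx]; ring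
      have h1 := mul_le_mul_of_nonneg_left hI hq
      have h2 : 0 < e * (X * P t ^ 2 + 8 * y - y * B * P t) := by
        refine mul_pos he0 ?_
        rw [hXy]
        have : 0 < y * ((B * P t / 4 - 2) ^ 2 + 4) := by positivity
        linarith
      have hwt : w t = e * P t ^ 2 := rfl
      rw [hwt]
      refine lt_of_lt_of_le h2 ?_
      refine le_trans (le_of_eq ?_) (add_le_add_right h1 _)
      have h3 : 8 * y ^ 2 * x ^ 2 = 8 * y * (1 - P t) := by rw [← hyx]; ring
      rw [h3, hXe, hB]
      -- All terms linear in t - m carry the derivative of the characteristic function at z, which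
      -- is zero.
      linear_combination (-e * (-4 * y * (x * P t))) * hcrit
    · intro t _ ht
      simp only [hv]
      rw [max_eq_left (hPout t ht)]
      simpa using (hpos t).le
  have := key m ⟨by linarith, by linarith⟩
  simp [hv, hP, hκ] at this
  linarith [hpos m]

/-- Comparison of a supersolution with a difference of two exponentials. -/
theorem exp_sub_exp_le_of_supersolution {N φ : ℝ → ℝ} {R c p q z z₁ l r a κ : ℝ}
    (hN0 : ∀ s, 0 ≤ N s) (hN : Integrable N) (hR : 0 ≤ R) (hq : 0 ≤ q) (hφ : ContDiff ℝ 2 φ)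
    (hpos : ∀ t, 0 < φ t) (hκ : 0 < κ) (hχ : 0 < truncChar N R c p q z)
    (hχ₁ : truncChar N R c p q z₁ ≤ truncChar N R c p q z)
    (hsuper : ∀ t ∈ Ioo l r, truncOp N R c p q φ t ≤ 0)
    (hbd : ∀ t ∈ Icc (l - R) (r + R), t ∉ Ioo l r →
      κ * (Real.exp (z * (t - a)) - Real.exp (z₁ * (t - a))) ≤ φ t) :
    ∀ t ∈ Ioo l r, κ * (Real.exp (z * (t - a)) - Real.exp (z₁ * (t - a))) ≤ φ t := by
  have hw1 : ∀ t, HasDerivAt (fun t => κ * (Real.exp (z * (t - a)) - Real.exp (z₁ * (t - a))))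
      (κ * (z * Real.exp (z * (t - a)) - z₁ * Real.exp (z₁ * (t - a)))) t := fun t =>
    ((hasDerivAt_exp_mul_sub z a t).sub (hasDerivAt_exp_mul_sub z₁ a t)).const_mul κ
  have hw2 : ∀ t, HasDerivAt (fun t =>
      κ * (z * Real.exp (z * (t - a)) - z₁ * Real.exp (z₁ * (t - a))))
      (κ * (z * (z * Real.exp (z * (t - a))) - z₁ * (z₁ * Real.exp (z₁ * (t - a))))) t := fun t =>
    (((hasDerivAt_exp_mul_sub z a t).const_mul z).sub
      ((hasDerivAt_exp_mul_sub z₁ a t).const_mul z₁)).const_mul κ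
  refine le_of_supersolution_of_subsolution
    (v := fun t => κ * (Real.exp (z * (t - a)) - Real.exp (z₁ * (t - a))))
    (w := fun t => κ * (Real.exp (z * (t - a)) - Real.exp (z₁ * (t - a))))
    hN0 hN hR hq hφ hpos (by fun_prop) (by fun_prop) (fun _ _ => rfl) hsuper ?_ hbd
  intro t _ ht
  obtain ⟨e1, e2⟩ := deriv_deriv_eq_of_hasDerivAt hw1 hw2 t
  rw [e1, e2]
  have i0 := hN.integrableOn_Icc_mul (v := fun s => Real.exp (-z * s)) (by fun_prop) (-R) R
  have i1 := hN.integrableOn_Icc_mul (v := fun s => Real.exp (-z₁ * s)) (by fun_prop) (-R) R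
  have hI : ∫ s in Icc (-R) R, N s * (κ * (Real.exp (z * (t - s - a))
      - Real.exp (z₁ * (t - s - a)))) = κ * (Real.exp (z * (t - a)) *
        (∫ s in Icc (-R) R, N s * Real.exp (-z * s)) - Real.exp (z₁ * (t - a)) *
        ∫ s in Icc (-R) R, N s * Real.exp (-z₁ * s)) := by
    rw [← integral_const_mul, ← integral_const_mul,
      ← integral_sub (i0.const_mul _) (i1.const_mul _), ← integral_const_mul]
    congr 1; funext s
    rw [show z * (t - s - a) = z * (t - a) + -z * s by ring,
      show z₁ * (t - s - a) = z₁ * (t - a) + -z₁ * s by ring, Real.exp_add, Real.exp_add]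
    ring
  rw [hI]
  have hlt : Real.exp (z₁ * (t - a)) < Real.exp (z * (t - a)) := by
    have := pos_of_mul_pos_right ht hκ.le
    linarith
  -- Each exponential is an eigenfunction with its characteristic value as eigenvalue; the larger
  -- exponential carries the larger value.
  have hmain : 0 < κ * (truncChar N R c p q z * Real.exp (z * (t - a))
      - truncChar N R c p q z₁ * Real.exp (z₁ * (t - a))) := by
    refine mul_pos hκ ?_
    have h1 := Real.exp_pos (z₁ * (t - a))
    nlinarith [mul_le_mul_of_nonneg_right hχ₁ h1.le, mul_lt_mul_of_pos_left hlt hχ]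
  rw [truncChar, truncChar] at hmain
  linarith

theorem hasDerivAt_truncChar {N : ℝ → ℝ} (hN0 : ∀ s, 0 ≤ N s) (hN : Integrable N)
    (R c p q z : ℝ) : HasDerivAt (truncChar N R c p q)
      (2 * z - c - q * ∫ s in Icc (-R) R, N s * (Real.exp (-z * s) * s)) z := by
  have hd : HasDerivAt (fun z => ∫ s in Icc (-R) R, N s * Real.exp (-z * s))
      (∫ s in Icc (-R) R, N s * (-(Real.exp (-z * s) * s))) z := by
    refine (hasDerivAt_integral_of_dominated_loc_of_deriv_le
      (F := fun z s => N s * Real.exp (-z * s))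
      (F' := fun z s => N s * (-(Real.exp (-z * s) * s)))
      (bound := fun s => N s * (Real.exp ((|z| + 1) * |R|) * |R|))
      (Metric.ball_mem_nhds z one_pos) ?_ ?_ ?_ ?_ ?_ ?_).2
    · exact Eventually.of_forall fun x =>
        (hN.integrableOn_Icc_mul (by fun_prop) (-R) R).aestronglyMeasurable
    · exact hN.integrableOn_Icc_mul (by fun_prop) (-R) R
    · exact (hN.integrableOn_Icc_mul (by fun_prop) (-R) R).aestronglyMeasurable
    · refine (ae_restrict_iff' measurableSet_Icc).2 (Eventually.of_forall fun s hs x hx => ?_)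
      rw [norm_mul, norm_neg, norm_mul, Real.norm_eq_abs, Real.norm_eq_abs, Real.norm_eq_abs,
        abs_of_nonneg (hN0 s), Real.abs_exp]
      have hsR : |s| ≤ |R| := (abs_le.2 hs).trans (le_abs_self R)
      have hx1 : |x| ≤ |z| + 1 := by
        rw [Metric.mem_ball, Real.dist_eq] at hx
        have := abs_sub_abs_le_abs_sub x z
        linarith
      have h1 : -x * s ≤ (|z| + 1) * |R| := by
        refine (le_abs_self _).trans ?_
        rw [abs_mul, abs_neg]
        exact mul_le_mul hx1 hsR (abs_nonneg _) (by positivity)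
      exact mul_le_mul_of_nonneg_left (mul_le_mul (Real.exp_le_exp.2 h1) hsR (abs_nonneg _)
        (Real.exp_pos _).le) (hN0 s)
    · exact hN.integrableOn.mul_const _
    · refine Eventually.of_forall fun s x _ => ?_
      have := (((hasDerivAt_id x).neg.mul_const s).exp).const_mul (N s)
      simpa using this
  have h1 : HasDerivAt (fun z : ℝ => z ^ 2 - c * z - p) (2 * z - c) z := by
    have := (((hasDerivAt_id z).pow 2).sub ((hasDerivAt_id z).const_mul c)).sub_const p
    simpa using this
  refine (h1.add (hd.const_mul q)).congr_deriv ?_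
  simp only [mul_neg, integral_neg]
  ring

/-- The bound T ≥ 2 leaves room for a test point at distance 1 from an end of an interval of length
T. -/
theorem exists_two_le_lt_exp (M : ℝ) {ε : ℝ} (hε : 0 < ε) :
    ∃ T : ℝ, 2 ≤ T ∧ M < Real.exp (ε * T) := by
  refine ⟨max 2 (M / ε), le_max_left _ _, ?_⟩
  have h1 : M ≤ ε * max 2 (M / ε) := by
    have := mul_le_mul_of_nonneg_left (le_max_right 2 (M / ε)) hε.le
    rwa [mul_div_cancel₀ _ hε.ne'] at this
  have := Real.add_one_le_exp (ε * max 2 (M / ε))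
  linarith

/-- If the truncated characteristic function is positive on `[-ε, k + 1]`, a positive
supersolution satisfying a Harnack inequality with exponent `k` does not attain its maximum over a
long interval at the right end. -/
theorem exists_length_no_supersolution_max_right {N : ℝ → ℝ} {R c p q ε k : ℝ}
    (hN0 : ∀ s, 0 ≤ N s) (hN : Integrable N) (hR : 0 ≤ R) (hq : 0 ≤ q) (hε : 0 < ε) (hk : 0 < k)
    (hχ : ∀ z ∈ Icc (-ε) (k + 1), 0 < truncChar N R c p q z) :
    ∃ T : ℝ, 0 < T ∧ ∀ (φ : ℝ → ℝ) (b : ℝ), ContDiff ℝ 2 φ → (∀ t, 0 < φ t) →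
      (∀ s t, φ s * Real.exp (-k * |t - s|) ≤ φ t) →
      (∀ t ∈ Icc (b - T - 2 * R) b, φ t ≤ φ b) →
      (∀ t ∈ Ioo (b - T - R) (b - R), truncOp N R c p q φ t ≤ 0) → False := by
  have hcont : Continuous (truncChar N R c p q) :=
    continuous_iff_continuousAt.2 fun z => (hasDerivAt_truncChar hN0 hN R c p q z).continuousAt
  obtain ⟨z₀, hz₀, hmin⟩ := isCompact_Icc.exists_isMinOn (⟨0, by linarith, by linarith⟩ :
    (Icc (-ε) (k + 1)).Nonempty) hcont.continuousOn
  have hmin' : ∀ z ∈ Icc (-ε) (k + 1), truncChar N R c p q z₀ ≤ truncChar N R c p q z := hmin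
  rcases eq_or_lt_of_le hz₀.1 with h1 | h1
  -- Minimum at -ε: the difference with rates -ε/2 and -ε is nonpositive left of b - T - R, and κ
  -- fits it under the Harnack bound on the right collar. One unit inside the left end it equals κc₀
  -- > φ b.
  · set c₀ := Real.exp (-(ε / 2)) - Real.exp (-ε) with hc₀
    have hc₀p : 0 < c₀ := sub_pos.2 (Real.exp_lt_exp.2 (by linarith))
    obtain ⟨T, hT2, hT⟩ := exists_two_le_lt_exp (Real.exp (k * R) / c₀) (half_pos hε)
    refine ⟨T, by linarith, fun φ b hφ hpos hH hb hsuper => ?_⟩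
    obtain ⟨κ, hκ⟩ : ∃ κ, κ = φ b * Real.exp (-(k * R)) * Real.exp (ε / 2 * T) := ⟨_, rfl⟩
    have hκ0 : 0 < κ := by rw [hκ]; have := hpos b; positivity
    have key := exp_sub_exp_le_of_supersolution (z := -(ε / 2)) (z₁ := -ε) (a := b - T - R)
      hN0 hN hR hq hφ hpos hκ0 (hχ _ ⟨by linarith, by linarith⟩)
      (by rw [h1]; exact hmin' _ ⟨by linarith, by linarith⟩) hsuper ?_ (b - T - R + 1)
      ⟨by linarith, by linarith⟩
    · have h2 := hb (b - T - R + 1) ⟨by linarith, by linarith⟩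
      rw [add_sub_cancel_left, mul_one, mul_one, ← hc₀] at key
      have h3 : φ b < κ * c₀ := by
        rw [div_lt_iff₀ hc₀p] at hT
        rw [hκ, mul_assoc, mul_assoc]
        refine lt_mul_of_one_lt_right (hpos b) ?_
        have := mul_lt_mul_of_pos_left hT (Real.exp_pos (-(k * R)))
        rwa [← Real.exp_add, neg_add_cancel, Real.exp_zero] at this
      linarith
    · intro t ht hnt
      rcases le_or_gt t (b - T - R) with htl | htl
      · refine le_trans (mul_nonpos_of_nonneg_of_nonpos hκ0.le (sub_nonpos.2
          (Real.exp_le_exp.2 ?_))) (hpos t).le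
        nlinarith
      · have htr : b - R ≤ t := by
          by_contra! hcon
          exact hnt ⟨htl, hcon⟩
        refine le_trans ?_ (hH b t)
        have h4 : κ * Real.exp (-(ε / 2) * (t - (b - T - R))) ≤ φ b * Real.exp (-k * |t - b|) := by
          rw [hκ, mul_assoc, mul_assoc, ← Real.exp_add, ← Real.exp_add]
          refine mul_le_mul_of_nonneg_left (Real.exp_le_exp.2 ?_) (hpos b).le
          have : |t - b| ≤ R := abs_le.2 ⟨by linarith, by linarith [ht.2]⟩
          nlinarith
        have := mul_pos hκ0 (Real.exp_pos (-ε * (t - (b - T - R))))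
        linarith
  rcases eq_or_lt_of_le hz₀.2 with h2 | h2
  -- Minimum at k + 1: the rate k + 1/2 exceeds k, so towards the left the difference decays faster
  -- than Harnack allows φ to. It is nonpositive from b - R on, and exceeds φ b one unit before b -
  -- R.
  · set c₀ := Real.exp (-(k + 1 / 2)) - Real.exp (-(k + 1)) with hc₀
    have hc₀p : 0 < c₀ := sub_pos.2 (Real.exp_lt_exp.2 (by linarith))
    obtain ⟨T, hT2, hT⟩ := exists_two_le_lt_exp (Real.exp (2 * (k * R)) / c₀) (half_pos one_pos)
    refine ⟨T, by linarith, fun φ b hφ hpos hH hb hsuper => ?_⟩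
    obtain ⟨κ, hκ⟩ : ∃ κ, κ = φ b * Real.exp (-(2 * (k * R))) * Real.exp (1 / 2 * T) := ⟨_, rfl⟩
    have hκ0 : 0 < κ := by rw [hκ]; have := hpos b; positivity
    have key := exp_sub_exp_le_of_supersolution (z := k + 1 / 2) (z₁ := k + 1) (a := b - R)
      hN0 hN hR hq hφ hpos hκ0 (hχ _ ⟨by linarith, by linarith⟩)
      (by rw [← h2]; exact hmin' _ ⟨by linarith, by linarith⟩) hsuper ?_ (b - R - 1)
      ⟨by linarith, by linarith⟩
    · have h3 := hb (b - R - 1) ⟨by linarith, by linarith⟩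
      rw [sub_sub_cancel_left, mul_neg_one, mul_neg_one, ← hc₀] at key
      have h4 : φ b < κ * c₀ := by
        rw [div_lt_iff₀ hc₀p] at hT
        rw [hκ, mul_assoc, mul_assoc]
        refine lt_mul_of_one_lt_right (hpos b) ?_
        have := mul_lt_mul_of_pos_left hT (Real.exp_pos (-(2 * (k * R))))
        rwa [← Real.exp_add, neg_add_cancel, Real.exp_zero] at this
      linarith
    · intro t ht hnt
      rcases le_or_gt (b - R) t with htr | htr
      · refine le_trans (mul_nonpos_of_nonneg_of_nonpos hκ0.le (sub_nonpos.2
          (Real.exp_le_exp.2 ?_))) (hpos t).le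
        nlinarith
      · have htl : t ≤ b - T - R := by
          by_contra! hcon
          exact hnt ⟨hcon, htr⟩
        refine le_trans ?_ (hH b t)
        have h4 : κ * Real.exp ((k + 1 / 2) * (t - (b - R))) ≤ φ b * Real.exp (-k * |t - b|) := by
          rw [hκ, mul_assoc, mul_assoc, ← Real.exp_add, ← Real.exp_add]
          refine mul_le_mul_of_nonneg_left (Real.exp_le_exp.2 ?_) (hpos b).le
          rw [abs_of_nonpos (by linarith)]
          nlinarith
        have := mul_pos hκ0 (Real.exp_pos ((k + 1) * (t - (b - R))))
        linarith
  · have hloc : IsLocalMin (truncChar N R c p q) z₀ := by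
      filter_upwards [Icc_mem_nhds h1 h2] with z hz using hmin' z hz
    obtain ⟨d, hd0, hd⟩ := exists_length_no_supersolution hN0 hN hR hq (hχ z₀ hz₀)
      (hloc.hasDerivAt_eq_zero (hasDerivAt_truncChar hN0 hN R c p q z₀))
    refine ⟨2 * d, by linarith, fun φ b hφ hpos _ _ hsuper => ?_⟩
    refine hd φ (b - R - d) hφ hpos fun t ht => hsuper t ⟨?_, ?_⟩ <;> linarith [ht.1, ht.2]

/-! ### Linear bounds near zero and the characteristic function -/

theorem exists_le_mul_of_derivZero_lt {f : ℝ → ℝ} {p : ℝ}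
    (hf : DifferentiableWithinAt ℝ f (Ici 0) 0) (hf0 : f 0 = 0) (hp : derivZero f < p) :
    ∃ δ > 0, ∀ u ∈ Icc 0 δ, f u ≤ p * u := by
  have hd : HasDerivWithinAt f (derivZero f) (Ici 0) 0 := hf.hasDerivWithinAt
  rw [hasDerivWithinAt_iff_tendsto_slope, Ici_sdiff_left] at hd
  obtain ⟨δ, hδ, h⟩ := (mem_nhdsGT_iff_exists_Ioc_subset).1 (hd.eventually (gt_mem_nhds hp))
  refine ⟨δ, hδ, fun u hu => ?_⟩
  rcases eq_or_lt_of_le hu.1 with h0 | h0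
  · rw [← h0, hf0, mul_zero]
  · have h1 : slope f 0 u < p := h ⟨h0, hu.2⟩
    rw [slope_def_field, hf0, sub_zero, sub_zero, div_lt_iff₀ h0] at h1
    exact h1.le

theorem exists_mul_le_of_lt_derivZero {f : ℝ → ℝ} {p : ℝ}
    (hf : DifferentiableWithinAt ℝ f (Ici 0) 0) (hf0 : f 0 = 0) (hp : p < derivZero f) :
    ∃ δ > 0, ∀ u ∈ Icc 0 δ, p * u ≤ f u := by
  have hd : derivZero (fun x => -f x) = -derivZero f := derivWithin.fun_neg
  obtain ⟨δ, hδ, h⟩ := exists_le_mul_of_derivZero_lt (f := fun x => -f x) (p := -p) hf.neg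
    (by simp [hf0]) (by rw [hd]; linarith)
  refine ⟨δ, hδ, fun u hu => ?_⟩
  have := h u hu
  linarith

namespace HypF

variable {f g K : ℝ → ℝ}

theorem g_deriv_pos (hF : HypF f g K) : 0 < derivZero g :=
  hF.f_deriv_pos.trans hF.f_deriv_lt_g_deriv

/-- Near 0 the derivative gives the bound; away from 0 monotonicity gives f u ≤ f M ≤ (f M / δ) u.
This supplies the β for Harnack. -/
theorem exists_f_le_mul (hF : HypF f g K) (M : ℝ) :
    ∃ β > 0, ∀ u ∈ Icc 0 M, f u ≤ β * u := by
  obtain ⟨δ, hδ, h⟩ := exists_le_mul_of_derivZero_lt hF.f_diff_zero hF.f_zero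
    (lt_add_one (derivZero f))
  have hp := hF.f_deriv_pos
  refine ⟨max (derivZero f + 1) (f M / δ), lt_max_of_lt_left (by linarith), fun u hu => ?_⟩
  rcases le_or_gt u δ with hud | hud
  · exact (h u ⟨hu.1, hud⟩).trans (mul_le_mul_of_nonneg_right (le_max_left _ _) hu.1)
  · have hM : (0 : ℝ) ≤ M := hu.1.trans hu.2
    have h1 : f u ≤ f M := hF.f_strictMono.monotoneOn hu.1 hM hu.2
    have h2 : 0 ≤ f M := by rw [← hF.f_zero]; exact hF.f_strictMono.monotoneOn self_mem_Ici hM hM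
    have h3 : f M / δ * u ≤ max (derivZero f + 1) (f M / δ) * u :=
      mul_le_mul_of_nonneg_right (le_max_right _ _) hu.1
    have h4 : f M ≤ f M / δ * u := by
      rw [div_mul_eq_mul_div, le_div_iff₀ hδ]
      exact mul_le_mul_of_nonneg_left hud.le h2
    linarith

theorem comp_neg (hF : HypF f g K) : HypF f g fun s => K (-s) :=
  { hF with
    K_nonneg := fun s => hF.K_nonneg (-s)
    K_integrable := hF.K_integrable.comp_neg
    K_integral := by rw [integral_neg_eq_self K volume, hF.K_integral] }

theorem integrable_mul_exp_shift_iff (K : ℝ → ℝ) (z a : ℝ) :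
    Integrable (fun s => K (s - a) * Real.exp (-z * s)) ↔ Admissible K z := by
  have h1 : (fun s => K (s - a) * Real.exp (-z * s)) =
      fun s => Real.exp (-z * a) * (fun s => K s * Real.exp (-z * s)) (s - a) := by
    funext s
    rw [show -z * s = -z * a + -z * (s - a) by ring, Real.exp_add]; ring
  rw [h1, Admissible]
  refine ⟨fun h => ?_, fun h => (h.comp_sub_right a).const_mul _⟩
  have h2 := (h.const_mul (Real.exp (-z * a))⁻¹).comp_add_right a
  refine h2.congr (Eventually.of_forall fun s => ?_)
  simp [Real.exp_ne_zero]

theorem chiOne_eq_integral_shift (f g K : ℝ → ℝ) (h z c : ℝ) : chiOne f g K h z c =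
    z ^ 2 - c * z - derivZero f + derivZero g * ∫ s, K (s - c * h) * Real.exp (-z * s) := by
  have h1 : (fun s => K (s - c * h) * Real.exp (-z * s)) =
      fun s => Real.exp (-z * c * h) * (fun s => K s * Real.exp (-z * s)) (s - c * h) := by
    funext s
    rw [show -z * s = -z * c * h + -z * (s - c * h) by ring, Real.exp_add]; ring
  rw [h1, integral_const_mul, integral_sub_right_eq_self (fun s => K s * Real.exp (-z * s)),
    chiOne, mul_assoc]

theorem integral_shift (hF : HypF f g K) (a : ℝ) : ∫ s, K (s - a) = 1 := by
  rw [integral_sub_right_eq_self K, hF.K_integral]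

theorem chiOne_zero_pos (hF : HypF f g K) (h c : ℝ) : 0 < chiOne f g K h 0 c := by
  have := hF.f_deriv_lt_g_deriv
  rw [chiOne_eq_integral_shift]
  simp only [neg_zero, zero_mul, Real.exp_zero, mul_one, hF.integral_shift]
  linarith

/-- By convexity `χ₁(·, c)` cannot be nonpositive on both sides of `0`. -/
theorem chiOne_pos_of_neg (hF : HypF f g K) {h c z₁ z₂ : ℝ} (hz₁ : 0 < z₁) (hz₂ : z₂ < 0)
    (h1 : Admissible K z₁) (h2 : Admissible K z₂) (hχ : chiOne f g K h z₁ c ≤ 0) :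
    0 < chiOne f g K h z₂ c := by
  rw [chiOne_eq_integral_shift] at hχ ⊢
  rw [← integrable_mul_exp_shift_iff K _ (c * h)] at h1 h2
  have hg := hF.g_deriv_pos
  have hfg := hF.f_deriv_lt_g_deriv
  set I₁ := ∫ s, K (s - c * h) * Real.exp (-z₁ * s)
  set I₂ := ∫ s, K (s - c * h) * Real.exp (-z₂ * s)
  have hI : (z₁ - z₂) * 1 ≤ -z₂ * I₁ + z₁ * I₂ := by
    rw [← hF.integral_shift (c * h), ← integral_const_mul, ← integral_const_mul,
      ← integral_const_mul, ← integral_add (h1.const_mul _) (h2.const_mul _)]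
    refine integral_mono ((hF.K_integrable.comp_sub_right (c * h)).const_mul _)
      ((h1.const_mul _).add (h2.const_mul _)) fun s => ?_
    have e1 := Real.add_one_le_exp (-z₁ * s)
    have e2 := Real.add_one_le_exp (-z₂ * s)
    have hK := hF.K_nonneg (s - c * h)
    -- In this combination the linear terms of the bounds e^x ≥ 1 + x cancel.
    have e3 : z₁ - z₂ ≤ -z₂ * Real.exp (-z₁ * s) + z₁ * Real.exp (-z₂ * s) := by
      nlinarith
    have := mul_le_mul_of_nonneg_right e3 hK
    beta_reduce
    linarith
  have h3 := mul_le_mul_of_nonneg_left hI hg.le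
  have h4 := mul_nonneg (by linarith : 0 ≤ -z₂) (neg_nonneg.2 hχ)
  have h5 : 0 < (z₁ - z₂) * (derivZero g - derivZero f) := mul_pos (by linarith) (by linarith)
  refine pos_of_mul_pos_right (a := z₁) ?_ hz₁.le
  have h6 : 0 ≤ -z₂ * z₁ * (z₁ - z₂) :=
    mul_nonneg (mul_nonneg (by linarith) hz₁.le) (by linarith)
  nlinarith

theorem admissible_comp_neg (K : ℝ → ℝ) (z : ℝ) :
    Admissible (fun s => K (-s)) z ↔ Admissible K (-z) := by
  constructor <;> intro h <;> simpa [Admissible] using Integrable.comp_neg h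

theorem chiOne_comp_neg (f g K : ℝ → ℝ) (h z c : ℝ) :
    chiOne f g (fun s => K (-s)) h z c = chiOne f g K h (-z) (-c) := by
  rw [chiOne, chiOne, ← integral_neg_eq_self (fun s => K (-s) * Real.exp (-z * s)) volume]
  simp

end HypF

theorem IsPositiveBoundedSolution.comp_neg {f g K φ : ℝ → ℝ} {h c : ℝ}
    (hφ : IsPositiveBoundedSolution f g K h c φ) :
    IsPositiveBoundedSolution f g (fun s => K (-s)) h (-c) fun t => φ (-t) where
  contDiff := hφ.contDiff.comp contDiff_neg
  pos t := hφ.pos (-t)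
  bdd := by
    obtain ⟨M, hM⟩ := hφ.bdd
    exact ⟨M, by rintro _ ⟨t, rfl⟩; exact hM ⟨-t, rfl⟩⟩
  eqn t := by
    obtain ⟨e1, e2⟩ := deriv_comp_neg_two (φ := φ) t
    rw [e1, e2, ← integral_neg_eq_self _ volume, ← hφ.eqn (-t)]
    have : ∀ s, -(t - -s - -c * h) = -t - s - c * h := fun s => by ring
    simp only [neg_neg, this]
    ring

/-! ### Exhaustion of χ₁ by truncations -/

namespace HypF

variable {f g K : ℝ → ℝ}

/-- Truncations of the characteristic equation which increase to `χ₁`. -/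
noncomputable def chiTrunc (f g K : ℝ → ℝ) (h c : ℝ) (n : ℕ) (z : ℝ) : ℝ :=
  truncChar (fun s => K (s - c * h)) n c (derivZero f + 1 / (n + 1))
    (derivZero g * (1 - 1 / (n + 1))) z

theorem one_div_add_one_le_one (n : ℕ) : 1 / ((n : ℝ) + 1) ≤ 1 := by
  rw [div_le_one (by positivity)]
  have : (0 : ℝ) ≤ n := n.cast_nonneg
  linarith

theorem monotone_chiTrunc (hF : HypF f g K) (h c z : ℝ) :
    Monotone fun n => chiTrunc f g K h c n z := by
  intro m n hmn
  have hmn' : (m : ℝ) ≤ n := by exact_mod_cast hmn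
  have h1 : 1 / ((n : ℝ) + 1) ≤ 1 / (m + 1) :=
    one_div_le_one_div_of_le (by positivity) (by linarith)
  have hg := hF.g_deriv_pos
  have hN0 : ∀ s, 0 ≤ K (s - c * h) * Real.exp (-z * s) := fun s =>
    mul_nonneg (hF.K_nonneg _) (Real.exp_pos _).le
  have hI : ∫ s in Icc (-(m : ℝ)) m, K (s - c * h) * Real.exp (-z * s) ≤
      ∫ s in Icc (-(n : ℝ)) n, K (s - c * h) * Real.exp (-z * s) :=
    setIntegral_mono_set ((hF.K_integrable.comp_sub_right (c * h)).integrableOn_Icc_mul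
      (by fun_prop) _ _) (Eventually.of_forall hN0)
      (LE.le.eventuallyLE (Icc_subset_Icc (by linarith) hmn'))
  have hI0 : 0 ≤ ∫ s in Icc (-(m : ℝ)) m, K (s - c * h) * Real.exp (-z * s) :=
    setIntegral_nonneg measurableSet_Icc fun s _ => hN0 s
  have := mul_le_mul (mul_le_mul_of_nonneg_left (sub_le_sub_left h1 1) hg.le) hI hI0
    (mul_nonneg hg.le (sub_nonneg.2 (one_div_add_one_le_one n)))
  simp only [chiTrunc, truncChar]
  linarith

/-- At an admissible z the truncations converge to χ₁. Otherwise, if none were positive, the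
truncated integrals would be bounded, forcing the integral to converge. -/
theorem exists_chiTrunc_pos (hF : HypF f g K) {h c z : ℝ}
    (hχ : Admissible K z → 0 < chiOne f g K h z c) : ∃ n, 0 < chiTrunc f g K h c n z := by
  have hg := hF.g_deriv_pos
  have hN0 : ∀ s, 0 ≤ K (s - c * h) * Real.exp (-z * s) := fun s =>
    mul_nonneg (hF.K_nonneg _) (Real.exp_pos _).le
  have hN : Integrable fun s => K (s - c * h) := hF.K_integrable.comp_sub_right (c * h)
  have hcov : AECover volume atTop fun n : ℕ => Icc (-(n : ℝ)) n :=
    aecover_Icc (tendsto_neg_atTop_atBot.comp tendsto_natCast_atTop_atTop)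
      tendsto_natCast_atTop_atTop
  have hη : Tendsto (fun n : ℕ => 1 / ((n : ℝ) + 1)) atTop (𝓝 0) :=
    tendsto_one_div_add_atTop_nhds_zero_nat
  by_cases hz : Admissible K z
  · have hint := hcov.integral_tendsto_of_countably_generated
      ((integrable_mul_exp_shift_iff K z (c * h)).2 hz)
    have hlim : Tendsto (fun n => chiTrunc f g K h c n z) atTop
        (𝓝 (z ^ 2 - c * z - (derivZero f + 0) + derivZero g * (1 - 0) *
          ∫ s, K (s - c * h) * Real.exp (-z * s))) :=
      (tendsto_const_nhds.sub (tendsto_const_nhds.add hη)).add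
        ((tendsto_const_nhds.mul (tendsto_const_nhds.sub hη)).mul hint)
    have hpos := hχ hz
    rw [chiOne_eq_integral_shift] at hpos
    exact (hlim.eventually (lt_mem_nhds (by simpa using hpos))).exists
  · by_contra! hcon
    refine hz ((integrable_mul_exp_shift_iff K z (c * h)).1 ?_)
    refine hcov.integrable_of_integral_bounded_of_nonneg_ae
      ((|z ^ 2 - c * z - derivZero f| + 1) / (derivZero g * (1 / 2)))
      (fun n => hN.integrableOn_Icc_mul (by fun_prop) _ _) (Eventually.of_forall hN0) ?_
    filter_upwards [hη.eventually (gt_mem_nhds (show (0 : ℝ) < 1 / 2 by norm_num))] with n hn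
    have h1 := hcon n
    simp only [chiTrunc, truncChar] at h1
    have hI0 : 0 ≤ ∫ s in Icc (-(n : ℝ)) n, K (s - c * h) * Real.exp (-z * s) :=
      setIntegral_nonneg measurableSet_Icc fun s _ => hN0 s
    rw [le_div_iff₀ (by positivity)]
    have h2 := mul_le_mul_of_nonneg_right (mul_le_mul_of_nonneg_left
      (by linarith : (1 : ℝ) / 2 ≤ 1 - 1 / (n + 1)) hg.le) hI0
    have h3 := neg_abs_le (z ^ 2 - c * z - derivZero f)
    linarith

/-- Uniform positivity of a truncation on a compact interval. -/
theorem exists_chiTrunc_pos_on_Icc (hF : HypF f g K) {h c : ℝ} (k : ℝ)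
    (hχ : ∀ z, 0 < z → Admissible K z → 0 < chiOne f g K h z c) :
    ∃ n, ∃ ε > 0, ∀ z ∈ Icc (-ε) (k + 1), 0 < chiTrunc f g K h c n z := by
  have hN : Integrable fun s => K (s - c * h) := hF.K_integrable.comp_sub_right (c * h)
  have hcont : ∀ n, Continuous (chiTrunc f g K h c n) := fun n =>
    continuous_iff_continuousAt.2 fun z =>
      (hasDerivAt_truncChar (fun s => hF.K_nonneg _) hN _ _ _ _ z).continuousAt
  have hopen : ∀ n, IsOpen {z | 0 < chiTrunc f g K h c n z} := fun n =>
    isOpen_lt continuous_const (hcont n)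
  -- The positivity sets are open and increase with n, so one of them covers the compact interval;
  -- openness at 0 then yields the margin ε.
  obtain ⟨n, hn⟩ := (isCompact_Icc (a := (0 : ℝ)) (b := max 0 (k + 1))).elim_directed_cover
    (fun n => {z | 0 < chiTrunc f g K h c n z}) hopen
    (fun z hz => by
      refine mem_iUnion.2 (hF.exists_chiTrunc_pos fun hadm => ?_)
      rcases eq_or_lt_of_le hz.1 with h0 | h0
      · rw [← h0]; exact hF.chiOne_zero_pos h c
      · exact hχ z h0 hadm)
    (Monotone.directed_le fun m n hmn z hz => lt_of_lt_of_le hz (hF.monotone_chiTrunc h c z hmn))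
  have h0 : (0 : ℝ) ∈ {z | 0 < chiTrunc f g K h c n z} := hn ⟨le_rfl, le_max_left _ _⟩
  obtain ⟨ε, hε, hball⟩ := Metric.isOpen_iff.1 (hopen n) 0 h0
  refine ⟨n, ε / 2, half_pos hε, fun z hz => ?_⟩
  rcases le_or_gt 0 z with hz0 | hz0
  · exact hn ⟨hz0, hz.2.trans (le_max_right _ _)⟩
  · refine hball ?_
    rw [Metric.mem_ball, Real.dist_eq, sub_zero, abs_of_neg hz0]
    linarith [hz.1]

end HypF

/-! ### Behaviour of small solutions -/

theorem Continuous.exists_first_hit {φ : ℝ → ℝ} (hφ : Continuous φ) {t x d : ℝ} (htx : t ≤ x)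
    (ht : φ t < d) (hx : d ≤ φ x) : ∃ b ∈ Icc t x, φ b = d ∧ ∀ s ∈ Icc t b, φ s ≤ d := by
  have hne : (Icc t x ∩ φ ⁻¹' {d}).Nonempty := by
    obtain ⟨b, hb, hbd⟩ := intermediate_value_Icc htx hφ.continuousOn ⟨ht.le, hx⟩
    exact ⟨b, hb, hbd⟩
  obtain ⟨b, ⟨hb, hbd⟩, hleast⟩ :=
    (isCompact_Icc.inter_right (isClosed_singleton.preimage hφ)).exists_isLeast hne
  refine ⟨b, hb, hbd, fun s hs => ?_⟩
  by_contra! hcon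
  obtain ⟨y, hy, hyd⟩ := intermediate_value_Icc hs.1 hφ.continuousOn ⟨ht.le, hcon.le⟩
  have h1 : b ≤ y := hleast ⟨⟨hy.1, hy.2.trans (hs.2.trans hb.2)⟩, hyd⟩
  have h2 : s = b := le_antisymm hs.2 (h1.trans hy.2)
  rw [h2, show φ b = d from hbd] at hcon
  exact lt_irrefl _ hcon

theorem Continuous.exists_last_hit {φ : ℝ → ℝ} (hφ : Continuous φ) {t y d : ℝ} (hyt : y ≤ t)
    (ht : φ t < d) (hy : d ≤ φ y) : ∃ a ∈ Icc y t, φ a = d ∧ ∀ s ∈ Icc a t, φ s ≤ d := by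
  obtain ⟨b, hb, hbd, h⟩ := Continuous.exists_first_hit (φ := fun s => φ (-s))
    (hφ.comp continuous_neg) (neg_le_neg hyt) (d := d) (by simpa using ht) (by simpa using hy)
  refine ⟨-b, ⟨by linarith [hb.2], by linarith [hb.1]⟩, hbd, fun s hs => ?_⟩
  have := h (-s) ⟨by linarith [hs.2], by linarith [hs.1]⟩
  simpa using this

namespace IsPositiveBoundedSolution

variable {f g K φ : ℝ → ℝ} {h c : ℝ}

theorem eqn_shift (hφ : IsPositiveBoundedSolution f g K h c φ) (t : ℝ) :
    deriv (deriv φ) t - c * deriv φ t =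
      f (φ t) - ∫ s, K (s - c * h) * g (φ (t - s)) := by
  have h1 := hφ.eqn t
  rw [← integral_sub_right_eq_self _ (c * h)] at h1
  have h2 : ∀ s, t - (s - c * h) - c * h = t - s := fun s => by ring
  simp only [h2] at h1
  linarith

theorem integrable_mul_g (hF : HypF f g K) (hφ : IsPositiveBoundedSolution f g K h c φ) (t : ℝ) :
    Integrable fun s => K (s - c * h) * g (φ (t - s)) := by
  obtain ⟨M, hM⟩ := hφ.bdd
  obtain ⟨C, hC⟩ := isCompact_Icc.exists_bound_of_continuousOn
    (hF.g_continuous.mono (Icc_subset_Ici_self : Icc 0 M ⊆ Ici 0))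
  have hcont : Continuous fun s => g (φ (t - s)) :=
    hF.g_continuous.comp_continuous (hφ.contDiff.continuous.comp (by fun_prop))
      fun s => (hφ.pos _).le
  exact (hF.K_integrable.comp_sub_right (c * h)).mul_bdd (c := C) hcont.aestronglyMeasurable
    (Eventually.of_forall fun s => hC _ ⟨(hφ.pos _).le, hM ⟨_, rfl⟩⟩)

theorem mul_g_nonneg (hF : HypF f g K) (hφ : IsPositiveBoundedSolution f g K h c φ) (t s : ℝ) :
    0 ≤ K (s - c * h) * g (φ (t - s)) :=
  mul_nonneg (hF.K_nonneg _) (hF.g_pos _ (hφ.pos _)).le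

theorem exists_harnack (hF : HypF f g K) (hφ : IsPositiveBoundedSolution f g K h c φ) :
    ∃ k > 0, ∀ s t, φ s * Real.exp (-k * |t - s|) ≤ φ t := by
  obtain ⟨M, hM⟩ := hφ.bdd
  obtain ⟨β, hβ, hf⟩ := hF.exists_f_le_mul M
  obtain ⟨k, hk, hH⟩ := _root_.exists_harnack c hβ
  refine ⟨k, hk, hH φ hφ.contDiff hφ.pos fun t => ?_⟩
  rw [hφ.eqn_shift t]
  have h1 := hf (φ t) ⟨(hφ.pos t).le, hM ⟨t, rfl⟩⟩
  have h2 : 0 ≤ ∫ s, K (s - c * h) * g (φ (t - s)) :=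
    integral_nonneg (hφ.mul_g_nonneg hF t)
  linarith

/-- Both slope bounds have the right sign for a supersolution, and the part of the nonlocal term
outside the window is nonnegative and can be dropped. -/
theorem truncOp_nonpos (hF : HypF f g K) (hφ : IsPositiveBoundedSolution f g K h c φ)
    {R p q δ t : ℝ} (hR : 0 ≤ R)
    (hf : ∀ u ∈ Icc 0 δ, f u ≤ p * u) (hg : ∀ u ∈ Icc 0 δ, q * u ≤ g u)
    (ht : ∀ x ∈ Icc (t - R) (t + R), φ x ≤ δ) :
    truncOp (fun s => K (s - c * h)) R c p q φ t ≤ 0 := by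
  have h1 : q * ∫ s in Icc (-R) R, K (s - c * h) * φ (t - s) ≤
      ∫ s, K (s - c * h) * g (φ (t - s)) := by
    rw [← integral_const_mul]
    refine le_trans ?_ (setIntegral_le_integral (hφ.integrable_mul_g hF t)
      (Eventually.of_forall (hφ.mul_g_nonneg hF t)) (s := Icc (-R) R))
    refine setIntegral_mono_on
      (((hF.K_integrable.comp_sub_right (c * h)).integrableOn_Icc_mul
        (hφ.contDiff.continuous.comp (by fun_prop)) _ _).const_mul _)
      (hφ.integrable_mul_g hF t).integrableOn measurableSet_Icc fun s hs => ?_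
    have h2 := hg (φ (t - s)) ⟨(hφ.pos _).le, ht _ ⟨by linarith [hs.2], by linarith [hs.1]⟩⟩
    have := mul_le_mul_of_nonneg_left h2 (hF.K_nonneg (s - c * h))
    linarith
  have h3 := hf (φ t) ⟨(hφ.pos _).le, ht _ ⟨by linarith, by linarith⟩⟩
  rw [truncOp, hφ.eqn_shift t]
  linarith

/-- If `χ₁(·, c)` has no nonpositive value on `(0, ∞)`, a small solution does not attain its
maximum over a long interval at the right end. -/
theorem exists_length_not_max_right (hF : HypF f g K)
    (hφ : IsPositiveBoundedSolution f g K h c φ)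
    (hχ : ∀ z, 0 < z → Admissible K z → 0 < chiOne f g K h z c) :
    ∃ δ > 0, ∃ A > 0, ∀ b, φ b ≤ δ → ¬ ∀ t ∈ Icc (b - A) b, φ t ≤ φ b := by
  obtain ⟨k, hk, hH⟩ := hφ.exists_harnack hF
  obtain ⟨n, ε, hε, hpos⟩ := hF.exists_chiTrunc_pos_on_Icc k hχ
  have hg := hF.g_deriv_pos
  have hη : (0 : ℝ) < 1 / (n + 1) := by positivity
  obtain ⟨δ₁, hδ₁, h1⟩ := exists_le_mul_of_derivZero_lt hF.f_diff_zero hF.f_zero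
    (lt_add_of_pos_right (derivZero f) hη)
  obtain ⟨δ₂, hδ₂, h2⟩ := exists_mul_le_of_lt_derivZero hF.g_diff_zero hF.g_zero
    (p := derivZero g * (1 - 1 / (n + 1))) (mul_lt_of_lt_one_right hg (by linarith))
  obtain ⟨T, hT, hno⟩ := exists_length_no_supersolution_max_right
    (fun s => hF.K_nonneg (s - c * h)) (hF.K_integrable.comp_sub_right (c * h)) n.cast_nonneg
    (mul_nonneg hg.le (sub_nonneg.2 (HypF.one_div_add_one_le_one n))) hε hk hpos
  have hn : (0 : ℝ) ≤ n := n.cast_nonneg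
  refine ⟨min δ₁ δ₂, lt_min hδ₁ hδ₂, T + 2 * n, by linarith, fun b hb hmax => ?_⟩
  rw [show b - (T + 2 * n) = b - T - 2 * n by ring] at hmax
  refine hno φ b hφ.contDiff hφ.pos hH hmax fun t ht => ?_
  refine hφ.truncOp_nonpos hF hn (δ := min δ₁ δ₂)
    (fun u hu => h1 u ⟨hu.1, hu.2.trans (min_le_left _ _)⟩)
    (fun u hu => h2 u ⟨hu.1, hu.2.trans (min_le_right _ _)⟩) fun x hx => ?_
  exact (hmax x ⟨by linarith [hx.1, ht.1], by linarith [hx.2, ht.2]⟩).trans hb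

theorem exists_length_not_max_left (hF : HypF f g K)
    (hφ : IsPositiveBoundedSolution f g K h c φ)
    (hχ : ∀ z, z < 0 → Admissible K z → 0 < chiOne f g K h z c) :
    ∃ δ > 0, ∃ A > 0, ∀ a, φ a ≤ δ → ¬ ∀ t ∈ Icc a (a + A), φ t ≤ φ a := by
  obtain ⟨δ, hδ, A, hA, hno⟩ := hφ.comp_neg.exists_length_not_max_right hF.comp_neg
    fun z hz hadm => by
      rw [HypF.chiOne_comp_neg, neg_neg]
      exact hχ _ (neg_neg_of_pos hz) ((HypF.admissible_comp_neg K z).1 hadm)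
  refine ⟨δ, hδ, A, hA, fun a ha hmax => hno (-a) (by simpa using ha) fun t ht => ?_⟩
  have := hmax (-t) ⟨by linarith [ht.2], by linarith [ht.1]⟩
  simpa using this

/-- A solution which oscillates at `-∞` around a positive level while approaching `0` stays small
between two points of equal height on arbitrarily long intervals. -/
theorem exists_long_excursion (hF : HypF f g K) (hφ : IsPositiveBoundedSolution f g K h c φ)
    (hfreq : ∀ η > 0, ∃ᶠ t in atBot, φ t < η) (hlim : ¬ Tendsto φ atBot (𝓝 0)) {δ A : ℝ}
    (hδ : 0 < δ) : ∃ a b, A ≤ b - a ∧ φ a ≤ δ ∧ φ b = φ a ∧ ∀ t ∈ Icc a b, φ t ≤ φ a := by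
  obtain ⟨k, hk, hH⟩ := hφ.exists_harnack hF
  rw [Metric.tendsto_nhds] at hlim
  push Not at hlim
  obtain ⟨δ₀, hδ₀, hbig⟩ := hlim
  have hbig' : ∃ᶠ t in atBot, δ₀ ≤ φ t := hbig.mono fun t ht => by
    simpa [Real.dist_eq, abs_of_pos (hφ.pos t)] using ht
  set d := min δ δ₀ with hd
  have hd0 : 0 < d := lt_min hδ hδ₀
  obtain ⟨x, hx⟩ := hbig'.exists
  -- By Harnack, climbing from this depth at t back to level d takes distance more than A.
  obtain ⟨t, htx, ht⟩ := frequently_atBot.1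
    (hfreq (d * Real.exp (-k * max A 0)) (by positivity)) x
  obtain ⟨y, hyt, hy⟩ := frequently_atBot.1 hbig' t
  have htd : φ t < d := ht.trans_le (mul_le_of_le_one_right hd0.le (Real.exp_le_one_iff.2 (by
    have := mul_nonneg hk.le (le_max_right A 0)
    linarith)))
  have hcont := hφ.contDiff.continuous
  obtain ⟨b, hb, hbd, hb'⟩ := Continuous.exists_first_hit hcont htx htd
    ((min_le_right _ _).trans hx)
  obtain ⟨a, ha, had, ha'⟩ := Continuous.exists_last_hit hcont hyt htd
    ((min_le_right _ _).trans hy)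
  refine ⟨a, b, ?_, had.le.trans (min_le_left _ _), hbd.trans had.symm, fun s hs => ?_⟩
  · have h1 := (hH b t).trans_lt ht
    rw [hbd] at h1
    have h2 := Real.exp_lt_exp.1 (lt_of_mul_lt_mul_left h1 hd0.le)
    have h3 : max A 0 < |t - b| := by nlinarith
    rw [abs_of_nonpos (by linarith [hb.1])] at h3
    linarith [le_max_left A 0, ha.2]
  · rw [had]
    rcases le_total s t with h1 | h1
    · exact ha' s ⟨hs.1, h1⟩
    · exact hb' s ⟨h1, hs.2⟩

/-- On a long excursion both ends are maxima, so whichever side of 0 has χ₁ positive yields a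
contradiction. -/
theorem tendsto_zero_of_frequently_lt (hF : HypF f g K)
    (hφ : IsPositiveBoundedSolution f g K h c φ) (hfreq : ∀ η > 0, ∃ᶠ t in atBot, φ t < η) :
    Tendsto φ atBot (𝓝 0) := by
  by_contra hlim
  by_cases hχ : ∀ z, 0 < z → Admissible K z → 0 < chiOne f g K h z c
  · obtain ⟨δ, hδ, A, _, hno⟩ := hφ.exists_length_not_max_right hF hχ
    obtain ⟨a, b, hab, h1, h2, h3⟩ := hφ.exists_long_excursion hF hfreq hlim (A := A) hδ
    refine hno b (h2.trans_le h1) fun t ht => ?_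
    rw [h2]
    exact h3 t ⟨by linarith [ht.1], ht.2⟩
  · push Not at hχ
    obtain ⟨z₁, hz₁, hadm₁, hχ₁⟩ := hχ
    obtain ⟨δ, hδ, A, _, hno⟩ := hφ.exists_length_not_max_left hF
      fun z hz hadm => hF.chiOne_pos_of_neg hz₁ hz hadm₁ hadm hχ₁
    obtain ⟨a, b, hab, h1, h2, h3⟩ := hφ.exists_long_excursion hF hfreq hlim (A := A) hδ
    exact hno a h1 fun t ht => h3 t ⟨ht.1, by linarith [ht.2]⟩

theorem exists_chiOne_nonpos (hF : HypF f g K) (hφ : IsPositiveBoundedSolution f g K h c φ)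
    (hlim : Tendsto φ atBot (𝓝 0)) :
    ∃ z, 0 < z ∧ Admissible K z ∧ chiOne f g K h z c ≤ 0 := by
  by_contra! hχ
  obtain ⟨δ, hδ, A, _, hno⟩ := hφ.exists_length_not_max_right hF hχ
  obtain ⟨x, hx⟩ := (eventually_atBot.1 (hlim.eventually (gt_mem_nhds hδ)))
  -- Left of y the solution is below φ x, so the maximum over the compact interval is a maximum over
  -- the whole half-line up to b.
  obtain ⟨y, hy⟩ := (eventually_atBot.1 (hlim.eventually (gt_mem_nhds (hφ.pos x))))
  obtain ⟨b, hb, hmax⟩ := isCompact_Icc.exists_isMaxOn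
    (⟨x, min_le_right y x, le_rfl⟩ : (Icc (min y x) x).Nonempty) hφ.contDiff.continuous.continuousOn
  refine hno b (hx b hb.2).le fun t ht => ?_
  have hxb : φ x ≤ φ b := hmax ⟨min_le_right _ _, le_rfl⟩
  rcases le_or_gt t y with h1 | h1
  · exact (hy t h1).le.trans hxb
  · exact hmax ⟨(min_le_left _ _).trans h1.le, ht.2.trans hb.2⟩

theorem frequently_lt_of_liminf_eq_zero {l : Filter ℝ} [l.NeBot]
    (hφ : IsPositiveBoundedSolution f g K h c φ)
    (hlim : liminf φ l = 0) {η : ℝ} (hη : 0 < η) : ∃ᶠ t in l, φ t < η := by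
  refine frequently_lt_of_liminf_lt ?_ (by rwa [hlim])
  obtain ⟨M, hM⟩ := hφ.bdd
  exact IsBoundedUnder.isCoboundedUnder_ge ⟨M, eventually_map.2 (Eventually.of_forall fun t =>
    hM ⟨t, rfl⟩)⟩

end IsPositiveBoundedSolution

/-! ### Bounds on the critical speeds -/

namespace HypF

variable {f g K : ℝ → ℝ}

theorem exists_lowerBound_speed (hF : HypF f g K) {h : ℝ} (hh : 0 ≤ h) :
    ∃ C : ℝ, ∀ c z, 0 < z → Admissible K z → chiOne f g K h z c = 0 → C ≤ c := by
  have hf := hF.f_deriv_pos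
  have hg := hF.g_deriv_pos
  have hcov : AECover volume atTop fun n : ℕ => Icc (-(n : ℝ)) n :=
    aecover_Icc (tendsto_neg_atTop_atBot.comp tendsto_natCast_atTop_atTop)
      tendsto_natCast_atTop_atTop
  have hlim := (hcov.integral_tendsto_of_countably_generated hF.K_integrable).const_mul
    (derivZero g)
  rw [hF.K_integral, mul_one] at hlim
  obtain ⟨n, hn⟩ := (hlim.eventually (lt_mem_nhds hF.f_deriv_lt_g_deriv)).exists
  set I := ∫ s in Icc (-(n : ℝ)) n, K s with hI
  have hI0 : 0 ≤ I := setIntegral_nonneg measurableSet_Icc fun s _ => hF.K_nonneg s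
  have hcont : ContinuousAt (fun z : ℝ => derivZero g * (Real.exp (-z * n) * I)) 0 := by fun_prop
  obtain ⟨ε, hε, hball⟩ := Metric.eventually_nhds_iff.1
    (hcont.eventually (lt_mem_nhds (by simpa using hn)))
  -- Below this negative speed χ₁ > 0 for all z > 0. For z < ε the nonlocal term alone beats f'(0),
  -- since h ≥ 0 makes e^{-zch} ≥ 1; for z ≥ ε the term -cz does.
  refine ⟨-(derivZero f / ε), fun c z hz hadm hzero => ?_⟩
  by_contra! hc
  have hq : 0 < derivZero f / ε := div_pos hf hε
  have hJ0 : 0 ≤ ∫ s, K s * Real.exp (-z * s) :=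
    integral_nonneg fun s => mul_nonneg (hF.K_nonneg s) (Real.exp_pos _).le
  have hE : 1 ≤ Real.exp (-z * c * h) := Real.one_le_exp (by
    have := mul_nonneg (mul_nonneg hz.le (by linarith : 0 ≤ -c)) hh
    linarith)
  rw [chiOne] at hzero
  have hcz : 0 < -c * z := mul_pos (by linarith) hz
  rcases lt_or_ge z ε with h1 | h1
  · have h2 := hball (y := z) (by rwa [Real.dist_eq, sub_zero, abs_of_pos hz])
    have h3 : Real.exp (-z * n) * I ≤ ∫ s, K s * Real.exp (-z * s) := by
      refine le_trans ?_ (setIntegral_le_integral hadm (Eventually.of_forall fun s =>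
        mul_nonneg (hF.K_nonneg s) (Real.exp_pos _).le) (s := Icc (-(n : ℝ)) n))
      rw [hI, ← integral_const_mul]
      refine setIntegral_mono_on (hF.K_integrable.integrableOn.const_mul _) hadm.integrableOn
        measurableSet_Icc fun s hs => ?_
      rw [mul_comm]
      exact mul_le_mul_of_nonneg_left (Real.exp_le_exp.2 (by nlinarith [hs.2])) (hF.K_nonneg s)
    have h4 := mul_le_mul_of_nonneg_left h3 hg.le
    have h5 := mul_le_mul_of_nonneg_right hE (mul_nonneg hg.le hJ0)
    nlinarith [sq_nonneg z]
  · have h2 : derivZero f ≤ -c * z := by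
      have h3 : derivZero f = derivZero f / ε * ε := (div_mul_cancel₀ _ hε.ne').symm
      rw [h3]
      exact mul_le_mul (by linarith) h1 hε.le (by linarith)
    have h5 := mul_nonneg (mul_nonneg hg.le (Real.exp_pos (-z * c * h)).le) hJ0
    have h6 : 0 < z ^ 2 := by positivity
    linarith

theorem exists_speed_le (hF : HypF f g K) {h c z : ℝ} (hz : 0 < z)
    (hχ : chiOne f g K h z c ≤ 0) : ∃ c' ≤ c, chiOne f g K h z c' = 0 := by
  have hg := hF.g_deriv_pos
  have hcont : Continuous fun c => chiOne f g K h z c := by unfold chiOne; fun_prop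
  have hJ0 : 0 ≤ ∫ s, K s * Real.exp (-z * s) :=
    integral_nonneg fun s => mul_nonneg (hF.K_nonneg s) (Real.exp_pos _).le
  -- At this speed -c₀z ≥ f'(0), so χ₁ ≥ 0 and the intermediate value theorem in the speed applies.
  set c₀ := min c (-(derivZero f / z))
  have h1 : 0 ≤ chiOne f g K h z c₀ := by
    have h2 : c₀ * z ≤ -(derivZero f / z) * z :=
      mul_le_mul_of_nonneg_right (min_le_right _ _) hz.le
    rw [neg_mul, div_mul_cancel₀ _ hz.ne'] at h2
    have h5 := mul_nonneg (mul_nonneg hg.le (Real.exp_pos (-z * c₀ * h)).le) hJ0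
    rw [chiOne]
    nlinarith [sq_nonneg z]
  obtain ⟨c', hc', hzero⟩ := intermediate_value_Icc' (min_le_left c (-(derivZero f / z)))
    hcont.continuousOn ⟨hχ, h1⟩
  exact ⟨c', hc'.2, hzero⟩

theorem criticalSpeedPlus_bounds (hF : HypF f g K) {h c z : ℝ} (hh : 0 ≤ h) (hz : 0 < z)
    (hadm : Admissible K z) (hχ : chiOne f g K h z c ≤ 0) :
    (⊥ < criticalSpeedPlus f g K h ∧ criticalSpeedPlus f g K h < ⊤) ∧
      criticalSpeedPlus f g K h ≤ (c : EReal) := by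
  obtain ⟨C, hC⟩ := hF.exists_lowerBound_speed hh
  obtain ⟨c', hc', hzero⟩ := hF.exists_speed_le hz hχ
  have h1 : criticalSpeedPlus f g K h ≤ (c : EReal) :=
    le_trans (b := (c' : EReal)) (sInf_le ⟨c', ⟨z, hz, hadm, hzero⟩, rfl⟩)
      (EReal.coe_le_coe_iff.2 hc')
  refine ⟨⟨(EReal.bot_lt_coe C).trans_le (le_sInf ?_), h1.trans_lt (EReal.coe_lt_top c)⟩, h1⟩
  rintro _ ⟨c'', ⟨z', hz', hadm', hzero'⟩, rfl⟩
  exact EReal.coe_le_coe_iff.2 (hC c'' z' hz' hadm' hzero')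

theorem criticalSpeedMinus_eq_neg (f g K : ℝ → ℝ) (h : ℝ) :
    criticalSpeedMinus f g K h = -criticalSpeedPlus f g (fun s => K (-s)) h := by
  have key : ∀ c z : ℝ, (z < 0 ∧ Admissible K z ∧ chiOne f g K h z c = 0) ↔
      (0 < -z ∧ Admissible (fun s => K (-s)) (-z) ∧
        chiOne f g (fun s => K (-s)) h (-z) (-c) = 0) := fun c z => by
    rw [admissible_comp_neg, chiOne_comp_neg, neg_neg, neg_neg, neg_pos]
  refine le_antisymm (sSup_le ?_) (EReal.neg_le_of_neg_le (le_sInf ?_))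
  · rintro _ ⟨c, ⟨z, hz⟩, rfl⟩
    refine EReal.le_neg_of_le_neg ?_
    rw [← EReal.coe_neg]
    exact sInf_le ⟨-c, ⟨-z, (key c z).1 hz⟩, rfl⟩
  · rintro _ ⟨c, ⟨z, hz⟩, rfl⟩
    refine EReal.neg_le_of_neg_le ?_
    rw [← EReal.coe_neg]
    exact le_sSup ⟨-c, ⟨-z, (key (-c) (-z)).2 (by simpa using hz)⟩, rfl⟩

end HypF

theorem IsPositiveBoundedSolution.exists_chiOne_nonpos_neg {f g K φ : ℝ → ℝ} {h c : ℝ}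
    (hF : HypF f g K) (hφ : IsPositiveBoundedSolution f g K h c φ)
    (hlim : Tendsto φ atTop (𝓝 0)) :
    ∃ z, z < 0 ∧ Admissible K z ∧ chiOne f g K h z c ≤ 0 := by
  obtain ⟨z, hz, hadm, hχ⟩ := hφ.comp_neg.exists_chiOne_nonpos hF.comp_neg
    (hlim.comp tendsto_neg_atBot_atTop)
  rw [HypF.chiOne_comp_neg, neg_neg] at hχ
  exact ⟨-z, neg_neg_of_pos hz, (HypF.admissible_comp_neg K z).1 hadm, hχ⟩

theorem HypF.criticalSpeedMinus_bounds {f g K : ℝ → ℝ} (hF : HypF f g K) {h c z : ℝ} (hh : 0 ≤ h)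
    (hz : z < 0) (hadm : Admissible K z) (hχ : chiOne f g K h z c ≤ 0) :
    (⊥ < criticalSpeedMinus f g K h ∧ criticalSpeedMinus f g K h < ⊤) ∧
      (c : EReal) ≤ criticalSpeedMinus f g K h := by
  obtain ⟨⟨h1, h2⟩, h3⟩ := hF.comp_neg.criticalSpeedPlus_bounds (h := h) (c := -c) hh
    (neg_pos.2 hz) ((HypF.admissible_comp_neg K (-z)).2 (by rwa [neg_neg]))
    (by rwa [HypF.chiOne_comp_neg, neg_neg, neg_neg])
  rw [HypF.criticalSpeedMinus_eq_neg]
  refine ⟨⟨?_, ?_⟩, EReal.le_neg_of_le_neg (by rwa [← EReal.coe_neg])⟩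
  · rw [bot_lt_iff_ne_bot, Ne, EReal.neg_eq_bot_iff]; exact h2.ne
  · rw [lt_top_iff_ne_top, Ne, EReal.neg_eq_top_iff]; exact h1.ne'

theorem mainTheorem5 (f g K : ℝ → ℝ) (h : ℝ) (hh : 0 ≤ h) (hF : HypF f g K) :
    (∀ (c : ℝ) (φ : ℝ → ℝ), IsPositiveBoundedSolution f g K h c φ →
      liminf φ atBot = 0 →
        Tendsto φ atBot (𝓝 0) ∧
        (⊥ < criticalSpeedPlus f g K h ∧ criticalSpeedPlus f g K h < ⊤) ∧
        criticalSpeedPlus f g K h ≤ (c : EReal)) ∧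
    (∀ (c : ℝ) (φ : ℝ → ℝ), IsPositiveBoundedSolution f g K h c φ →
      liminf φ atTop = 0 →
        Tendsto φ atTop (𝓝 0) ∧
        (⊥ < criticalSpeedMinus f g K h ∧ criticalSpeedMinus f g K h < ⊤) ∧
        (c : EReal) ≤ criticalSpeedMinus f g K h) ∧
    (∀ (c : ℝ) (φ : ℝ → ℝ), ¬ IsPulse f g K h c φ) ∧
    (∀ c : ℝ, criticalSpeedMinus f g K h < (c : EReal) → (c : EReal) < criticalSpeedPlus f g K h →
      ∀ φ : ℝ → ℝ, ¬ IsSemiWavefront f g K h c φ) := by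
  refine ⟨fun c φ hφ hlim => ?_, fun c φ hφ hlim => ?_, ?_, ?_⟩
  · have ht := hφ.tendsto_zero_of_frequently_lt hF
      fun η hη => hφ.frequently_lt_of_liminf_eq_zero hlim hη
    obtain ⟨z, hz, hadm, hχ⟩ := hφ.exists_chiOne_nonpos hF ht
    exact ⟨ht, hF.criticalSpeedPlus_bounds hh hz hadm hχ⟩
  · have ht' := hφ.comp_neg.tendsto_zero_of_frequently_lt hF.comp_neg fun η hη => by
      have := hφ.frequently_lt_of_liminf_eq_zero hlim hη
      rw [← map_neg_atBot, frequently_map] at this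
      exact this
    have ht : Tendsto φ atTop (𝓝 0) := by
      simpa [Function.comp_def] using ht'.comp tendsto_neg_atTop_atBot
    obtain ⟨z, hz, hadm, hχ⟩ := hφ.exists_chiOne_nonpos_neg hF ht
    exact ⟨ht, hF.criticalSpeedMinus_bounds hh hz hadm hχ⟩
  · rintro c φ ⟨hφ, hbot, htop⟩
    obtain ⟨z₁, hz₁, hadm₁, hχ₁⟩ := hφ.exists_chiOne_nonpos hF hbot
    obtain ⟨z₂, hz₂, hadm₂, hχ₂⟩ := hφ.exists_chiOne_nonpos_neg hF htop
    exact (hF.chiOne_pos_of_neg hz₁ hz₂ hadm₁ hadm₂ hχ₁).not_ge hχ₂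
  · rintro c hlow hup φ ⟨hφ, hbot | htop⟩
    · obtain ⟨z, hz, hadm, hχ⟩ := hφ.exists_chiOne_nonpos hF hbot
      exact (hF.criticalSpeedPlus_bounds hh hz hadm hχ).2.not_gt hup
    · obtain ⟨z, hz, hadm, hχ⟩ := hφ.exists_chiOne_nonpos_neg hF htop
      exact (hF.criticalSpeedMinus_bounds hh hz hadm hχ).2.not_gt hlow
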